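/- Consider three qubits with the Hamiltonian $H=H_1\otimes\mathbf I\otimes\mathbf I+\mathbf I\otimes H_2\otimes\mathbf I+\mathbf I\otimes\mathbf I\otimes H_3$, where $H_l=\sum_{j=0}^{1}(E_l+j\alpha_l)|j\rangle\langle j|$ with $E_l\in\mathbb R$ and $\alpha_l>0$ for $l=1,2,3$. Put $H_{12}=H_1\otimes\mathbf I+\mathbf I\otimes H_2$. For a state $\sigma$ of a system with Hamiltonian $K$ let $W_K(\sigma)=\operatorname{Tr}[\sigma K]-\min_{U}\operatorname{Tr}[U\sigma U^\dagger K]$ (the minimum over all unitaries $U$) be its ergotropy. For a three-qubit state $\rho$ with marginals $\rho_{12}=\operatorname{Tr}_3\rho$ and $\rho_3=\operatorname{Tr}_{12}\rho$ define $$\Delta_{12|3}:=W_H(\rho)-W_{H_{12}}(\rho_{12})-\operatorname{Tr}[\rho_3H_3]+E_g^{3},$$ where $E_g^{3}$ is the least eigenvalue of $H_3$. Suppose $\rho$ is separable across the $12|3$ cut, i.e. $\rho=\sum_i p_i\,|\psi_i\rangle\langle\psi_i|\otimes|\phi_i\rangle\langle\phi_i|$ is a finite mixture ($p_i\ge 0$,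 $\sum_i p_i=1$) with unit vectors $\psi_i\in\mathbb C^2\otimes\mathbb C^2$ (qubits 1, 2) and $\phi_i\in\mathbb C^2$ (qubit 3). Then: 1. if $\alpha_1<\alpha_2=\alpha_3=:\alpha$, then $\Delta_{12|3}\le \dfrac{\alpha_1}{4}$; 2. if $\alpha_1=\alpha_2=:\alpha>\alpha_3$ and $\alpha_3\ge\frac23\alpha$, then $\Delta_{12|3}\le\dfrac{\alpha-\alpha_3}{4}+\dfrac{\alpha}{4}$; 3. if $\alpha_1=\alpha_2=:\alpha>\alpha_3$ and $\alpha_3\le\frac23\alpha$, then $\Delta_{12|3}\le\dfrac{\alpha-\alpha_3}{2}+\dfrac{\alpha}{6}$. -/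

import Mathlib

open scoped Kronecker ComplexOrder

noncomputable section

namespace QubitErgotropy

/-- A density matrix: a positive semidefinite complex matrix of trace one. -/
def IsDensityMatrix {n : Type*} [Fintype n] (ρ : Matrix n n ℂ) : Prop :=
  ρ.PosSemidef ∧ ρ.trace = 1

/-- `ψ` is a unit vector of the Hilbert space `ℂⁿ`. -/
def IsUnitVector {n : Type*} [Fintype n] (ψ : n → ℂ) : Prop :=
  ∑ i, ‖ψ i‖ ^ 2 = 1

/-- The rank-one projector `|ψ⟩⟨ψ|`. -/
def pureState {n : Type*} (ψ : n → ℂ) : Matrix n n ℂ :=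
  Matrix.vecMulVec ψ (star ψ)

/-- `ρ` on `ℂᵃ ⊗ ℂᵇ` is separable across the cut `a` versus `b`: it is a (finite) probabilistic
mixture of product states `|ψᵢ⟩⟨ψᵢ| ⊗ |φᵢ⟩⟨φᵢ|`. -/
def IsSeparable {a b : Type*} [Fintype a] [Fintype b] (ρ : Matrix (a × b) (a × b) ℂ) : Prop :=
  ∃ (k : ℕ) (p : Fin k → ℝ) (ψ : Fin k → a → ℂ) (φ : Fin k → b → ℂ),
    (∀ i, 0 ≤ p i) ∧ ∑ i, p i = 1 ∧
    (∀ i, IsUnitVector (ψ i)) ∧ (∀ i, IsUnitVector (φ i)) ∧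
    ρ = ∑ i, (p i : ℂ) • (pureState (ψ i) ⊗ₖ pureState (φ i))

/-- The marginal on the first factor, `Tr_b ρ`. -/
def marginalFst {a b : Type*} [Fintype b] (ρ : Matrix (a × b) (a × b) ℂ) : Matrix a a ℂ :=
  Matrix.of fun i j => ∑ k, ρ (i, k) (j, k)

/-- The marginal on the second factor, `Tr_a ρ`. -/
def marginalSnd {a b : Type*} [Fintype a] (ρ : Matrix (a × b) (a × b) ℂ) : Matrix b b ℂ :=
  Matrix.of fun i j => ∑ k, ρ (k, i) (k, j)

/-- The mean energy `Tr[ρ H]` (a real number when `ρ` and `H` are Hermitian). -/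
def energy {n : Type*} [Fintype n] (H ρ : Matrix n n ℂ) : ℝ :=
  (ρ * H).trace.re

/-- The least energy `min_U Tr[U ρ U† H]` over all unitaries `U`, that is, the energy of the
passive state of `ρ`. The minimum is attained, see `exists_energy_eq_passiveEnergy`. -/
def passiveEnergy {n : Type*} [Fintype n] [DecidableEq n] (H ρ : Matrix n n ℂ) : ℝ :=
  ⨅ U : Matrix.unitaryGroup n ℂ,
    energy H ((U : Matrix n n ℂ) * ρ * (U : Matrix n n ℂ).conjTranspose)

/-- The ergotropy `W(ρ) = Tr[ρ H] - min_U Tr[U ρ U† H]`. -/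
def ergotropy {n : Type*} [Fintype n] [DecidableEq n] (H ρ : Matrix n n ℂ) : ℝ :=
  energy H ρ - passiveEnergy H ρ

/-- The ground state energy of a Hamiltonian: its least eigenvalue. -/
def groundEnergy {n : Type*} [Fintype n] [DecidableEq n] (H : Matrix n n ℂ) : ℝ :=
  sInf (spectrum ℝ H)

/-- The thermodynamic quantity
`Δ_{X|Xᶜ} = W(ρ) - W(ρ_X) - E(ρ_{Xᶜ}) + E_g^{Xᶜ}` of a state `ρ` on `X ⊗ Xᶜ`, for the global
Hamiltonian `H` and the Hamiltonians `HX`, `HXc` of the two parts. -/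
def thermoGap {a b : Type*} [Fintype a] [Fintype b] [DecidableEq a] [DecidableEq b]
    (H : Matrix (a × b) (a × b) ℂ) (HX : Matrix a a ℂ) (HXc : Matrix b b ℂ)
    (ρ : Matrix (a × b) (a × b) ℂ) : ℝ :=
  ergotropy H ρ - ergotropy HX (marginalFst ρ) - energy HXc (marginalSnd ρ) + groundEnergy HXc

/-- The one-qubit Hamiltonian `∑_{j=0,1} (E + j α) |j⟩⟨j|`. -/
def qubitHamiltonian (E α : ℝ) : Matrix (Fin 2) (Fin 2) ℂ :=
  Matrix.diagonal fun j => ((E + (j : ℕ) * α : ℝ) : ℂ)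

/-- The two-qubit Hamiltonian `H₁ ⊗ 1 + 1 ⊗ H₂`. -/
def hamiltonian₂ (H₁ H₂ : Matrix (Fin 2) (Fin 2) ℂ) :
    Matrix (Fin 2 × Fin 2) (Fin 2 × Fin 2) ℂ :=
  H₁ ⊗ₖ 1 + 1 ⊗ₖ H₂

/-- The three-qubit Hamiltonian `H₁ ⊗ 1 ⊗ 1 + 1 ⊗ H₂ ⊗ 1 + 1 ⊗ 1 ⊗ H₃`, with the tensor factors
bracketed as `(ℂ² ⊗ ℂ²) ⊗ ℂ²`. -/
def hamiltonian₃ (H₁ H₂ H₃ : Matrix (Fin 2) (Fin 2) ℂ) :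
    Matrix ((Fin 2 × Fin 2) × Fin 2) ((Fin 2 × Fin 2) × Fin 2) ℂ :=
  (H₁ ⊗ₖ 1) ⊗ₖ 1 + (1 ⊗ₖ H₂) ⊗ₖ 1 + (1 ⊗ₖ 1) ⊗ₖ H₃

/-- `Δ_{12|3}(ρ)` for three qubits with the local Hamiltonians
`H_l = ∑_j (E_l + j α_l) |j⟩⟨j|`, `l = 1, 2, 3`. -/
def delta12_3 (E₁ E₂ E₃ α₁ α₂ α₃ : ℝ)
    (ρ : Matrix ((Fin 2 × Fin 2) × Fin 2) ((Fin 2 × Fin 2) × Fin 2) ℂ) : ℝ :=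
  thermoGap
    (hamiltonian₃ (qubitHamiltonian E₁ α₁) (qubitHamiltonian E₂ α₂) (qubitHamiltonian E₃ α₃))
    (hamiltonian₂ (qubitHamiltonian E₁ α₁) (qubitHamiltonian E₂ α₂))
    (qubitHamiltonian E₃ α₃) ρ

/-- The unitary matrices form a compact set. -/
theorem isCompact_unitaryGroup (n : Type*) [Fintype n] [DecidableEq n] :
    IsCompact (Matrix.unitaryGroup n ℂ : Set (Matrix n n ℂ)) := by
  have hbox : IsCompact {A : Matrix n n ℂ | A ∈ Set.univ.pi fun _ : n => Set.univ.pi fun _ : n =>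
      Metric.closedBall (0 : ℂ) 1} :=
    isCompact_univ_pi fun _ => isCompact_univ_pi fun _ => isCompact_closedBall _ _
  have hcl : IsClosed (Matrix.unitaryGroup n ℂ : Set (Matrix n n ℂ)) := by
    have h : (Matrix.unitaryGroup n ℂ : Set (Matrix n n ℂ)) =
        {A : Matrix n n ℂ | A * A.conjTranspose = 1} :=
      Set.ext fun A => Matrix.mem_unitaryGroup_iff
    rw [h]
    exact isClosed_eq (continuous_id.matrix_mul continuous_id.matrix_conjTranspose)
      continuous_const
  refine hbox.of_isClosed_subset hcl fun A hA i _ j _ => ?_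
  rw [mem_closedBall_zero_iff]
  exact entry_norm_bound_of_unitary hA i j

/-- The minimum over unitaries in `passiveEnergy` is attained (and is a lower bound). -/
theorem exists_energy_eq_passiveEnergy {n : Type*} [Fintype n] [DecidableEq n]
    (H ρ : Matrix n n ℂ) :
    ∃ U : Matrix.unitaryGroup n ℂ,
      energy H ((U : Matrix n n ℂ) * ρ * (U : Matrix n n ℂ).conjTranspose) = passiveEnergy H ρ ∧
      ∀ V : Matrix.unitaryGroup n ℂ, passiveEnergy H ρ ≤
        energy H ((V : Matrix n n ℂ) * ρ * (V : Matrix n n ℂ).conjTranspose) := by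
  have hc : Continuous fun A : Matrix n n ℂ => energy H (A * ρ * A.conjTranspose) := by
    have h : Continuous fun A : Matrix n n ℂ => A * ρ * A.conjTranspose * H :=
      ((continuous_id.matrix_mul continuous_const).matrix_mul
        continuous_id.matrix_conjTranspose).matrix_mul continuous_const
    exact Complex.continuous_re.comp h.matrix_trace
  have hex : ∃ U ∈ (Matrix.unitaryGroup n ℂ : Set (Matrix n n ℂ)),
      IsMinOn (fun A : Matrix n n ℂ => energy H (A * ρ * A.conjTranspose))
        (Matrix.unitaryGroup n ℂ : Set (Matrix n n ℂ)) U :=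
    (isCompact_unitaryGroup n).exists_isMinOn ⟨1, Submonoid.one_mem _⟩ hc.continuousOn
  refine hex.elim fun U hU => ?_
  have hle : ∀ V : Matrix.unitaryGroup n ℂ,
      energy H (U * ρ * U.conjTranspose) ≤
        energy H ((V : Matrix n n ℂ) * ρ * (V : Matrix n n ℂ).conjTranspose) :=
    fun V => isMinOn_iff.mp hU.2 V.1 V.2
  have hbdd : BddBelow (Set.range fun V : Matrix.unitaryGroup n ℂ =>
      energy H ((V : Matrix n n ℂ) * ρ * (V : Matrix n n ℂ).conjTranspose)) :=
    ⟨_, Set.forall_mem_range.mpr hle⟩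
  exact ⟨⟨U, hU.1⟩, le_antisymm (le_ciInf hle) (ciInf_le hbdd ⟨U, hU.1⟩),
    fun V => ciInf_le hbdd V⟩

/-- The ground state energy of a qubit with `0 ≤ α` is `E`. -/
theorem groundEnergy_qubitHamiltonian (E α : ℝ) (hα : 0 ≤ α) :
    groundEnergy (qubitHamiltonian E α) = E := by
  have h : spectrum ℝ (qubitHamiltonian E α) = {E, E + α} := by
    rw [← spectrum.preimage_algebraMap ℂ, qubitHamiltonian, spectrum_diagonal]
    ext x
    simp only [Set.mem_preimage, Set.mem_range, Fin.exists_fin_two, Complex.coe_algebraMap,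
      Complex.ofReal_inj, Set.mem_insert_iff, Set.mem_singleton_iff]
    simp [eq_comm]
  rw [groundEnergy, h, csInf_pair]
  simpa using hα

end QubitErgotropy

end

/-!
A separable state satisfies the reduction criterion `ρ ≤ ρ_a ⊗ 1`. Since `ρ = √ρ √ρ`, this lets one
factor `√ρ` through the square root of `ρ_a ⊗ 1` by a contraction, and the squared moduli of its
entries form a substochastic matrix taking the spectrum of `ρ_a` to the diagonal of `U ρ U†`, for
every unitary `U`. For non-interacting Hamiltonians the mean energies cancel in `Δ`, which becomes
a difference of passive energies. Abel summation along the ordered spectrum of `ρ_a`, together with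
the fact that weights in `[0, 1]` of integral total mass do best on the lowest levels, then reduces
a bound on `Δ` to comparing sums of the `m` lowest levels of the two Hamiltonians. For three qubits
this is a count of excitations in sets of at most four of the eight levels.
-/

namespace QubitErgotropy

open Finset Matrix
open scoped MatrixOrder

section Majorization

theorem sum_mul_nonneg_of_antitone {d : ℕ} {c ν : Fin d → ℝ} (hanti : Antitone ν)
    (hν : ∀ i, 0 ≤ ν i) (hc : ∀ i, ν i ≠ 0 → 0 ≤ ∑ j ∈ Iic i, c j) : 0 ≤ ∑ i, c i * ν i := by
  induction d with
  | zero => simp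
  | succ d ih =>
    -- Splitting off the constant sequence `t` leaves an antitone sequence that vanishes at the end.
    set t : ℝ := ν (Fin.last d)
    have hlast : 0 ≤ (∑ i, c i) * t := by
      rcases eq_or_ne t 0 with h | h
      · rw [h, mul_zero]
      · have := hc (Fin.last d) h
        rw [← Fin.top_eq_last, Iic_top] at this
        exact mul_nonneg this (hν _)
    have hinit : 0 ≤ ∑ i : Fin d, c i.castSucc * (ν i.castSucc - t) := by
      refine ih (fun i j hij => sub_le_sub_right (hanti (Fin.castSucc_le_castSucc_iff.mpr hij)) t)
        (fun i => sub_nonneg.mpr (hanti (Fin.le_last _))) fun i hi => ?_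
      have hi' : ν i.castSucc ≠ 0 := fun h => hi <| le_antisymm
        (sub_nonpos.mpr (h.trans_le (hν _))) (sub_nonneg.mpr (hanti (Fin.le_last _)))
      simpa [← Fin.map_castSuccEmb_Iic] using hc i.castSucc hi'
    calc 0 ≤ ∑ i : Fin d, c i.castSucc * (ν i.castSucc - t) + (∑ i, c i) * t :=
          add_nonneg hinit hlast
      _ = ∑ i, c i * ν i := by
          simp only [Fin.sum_univ_castSucc, mul_sub, sum_sub_distrib, ← sum_mul]
          ring

variable {κ : Type*} [Fintype κ]

theorem exists_card_eq_and_threshold (e : κ → ℝ) {m : ℕ} (hm : m ≤ Fintype.card κ) :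
    ∃ (S : Finset κ) (t : ℝ), #S = m ∧ (∀ k ∈ S, e k ≤ t) ∧ ∀ k ∉ S, t ≤ e k := by
  classical
  induction m with
  | zero =>
    obtain ⟨t, ht⟩ := (Set.finite_range e).bddBelow
    exact ⟨∅, t, rfl, by simp, fun k _ => ht ⟨k, rfl⟩⟩
  | succ m ih =>
    obtain ⟨S, t, hS, hle, hge⟩ := ih (by lia)
    have hne : Sᶜ.Nonempty := by
      rw [← card_pos, card_compl]
      lia
    obtain ⟨l, hl, hmin⟩ := exists_min_image Sᶜ e hne
    rw [mem_compl] at hl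
    refine ⟨insert l S, e l, by rw [card_insert_of_notMem hl, hS], fun k hk => ?_, fun k hk => ?_⟩
    · rcases mem_insert.mp hk with rfl | hk
      · exact le_rfl
      · exact (hle k hk).trans (hge l hl)
    · exact hmin k (mem_compl.mpr fun h => hk (mem_insert_of_mem h))

theorem exists_card_eq_and_sum_le_sum_mul (e : κ → ℝ) {w : κ → ℝ} {m : ℕ} (h0 : ∀ k, 0 ≤ w k)
    (h1 : ∀ k, w k ≤ 1) (hw : ∑ k, w k = m) :
    ∃ S : Finset κ, #S = m ∧ ∑ k ∈ S, e k ≤ ∑ k, e k * w k := by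
  classical
  have hm : m ≤ Fintype.card κ := by
    have : (m : ℝ) ≤ Fintype.card κ := by
      simpa [← hw] using sum_le_sum fun k (_ : k ∈ univ) => h1 k
    exact_mod_cast this
  obtain ⟨S, t, hS, hle, hge⟩ := exists_card_eq_and_threshold e hm
  have hexchange : 0 ≤ ∑ k, (e k - t) * (w k - if k ∈ S then 1 else 0) := by
    refine sum_nonneg fun k _ => ?_
    split_ifs with hk
    · exact mul_nonneg_of_nonpos_of_nonpos (sub_nonpos.mpr (hle k hk)) (sub_nonpos.mpr (h1 k))
    · simpa using mul_nonneg (sub_nonneg.mpr (hge k hk)) (h0 k)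
  refine ⟨S, hS, ?_⟩
  simp only [sub_mul, mul_sub, sum_sub_distrib, mul_ite, mul_one, mul_zero, sum_ite_mem, univ_inter,
    ← mul_sum, hw, sum_const, hS, nsmul_eq_mul] at hexchange
  linarith

theorem sum_mul_le_sum_mul_of_substochastic {d : ℕ} {D : κ → Fin d → ℝ} {c ν : Fin d → ℝ}
    {e : κ → ℝ} (hanti : Antitone ν) (hν : ∀ i, 0 ≤ ν i) (hD : ∀ k i, 0 ≤ D k i)
    (hrow : ∀ k, ∑ i, D k i ≤ 1) (hcol : ∀ i, ν i ≠ 0 → ∑ k, D k i = 1)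
    (hc : ∀ (i : Fin d) (S : Finset κ), #S = (i : ℕ) + 1 → ∑ j ∈ Iic i, c j ≤ ∑ k ∈ S, e k) :
    ∑ i, c i * ν i ≤ ∑ k, e k * ∑ i, D k i * ν i := by
  suffices h : 0 ≤ ∑ i, (∑ k, e k * D k i - c i) * ν i by
    have hswap : ∑ k, e k * ∑ i, D k i * ν i = ∑ i, (∑ k, e k * D k i) * ν i := by
      simp only [mul_sum, sum_mul, mul_assoc]
      exact sum_comm
    simp only [sub_mul, sum_sub_distrib] at h
    rw [hswap]
    linarith
  refine sum_mul_nonneg_of_antitone hanti hν fun i hi => ?_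
  have hcol' : ∀ j ∈ Iic i, ∑ k, D k j = 1 := fun j hj =>
    hcol j (((hν i).lt_of_ne' hi).trans_le (hanti (mem_Iic.mp hj))).ne'
  obtain ⟨S, hS, hle⟩ := exists_card_eq_and_sum_le_sum_mul e (w := fun k => ∑ j ∈ Iic i, D k j)
    (m := i + 1) (fun k => sum_nonneg fun j _ => hD k j)
    (fun k => (sum_le_univ_sum_of_nonneg (hD k)).trans (hrow k))
    (by rw [sum_comm, sum_congr rfl hcol']; simp)
  simp only [mul_sum] at hle
  rw [sum_comm] at hle
  rw [sum_sub_distrib, sub_nonneg]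
  exact (hc i S hS).trans hle

end Majorization

section Loewner

variable {m n : Type*}

theorem re_apply_self_le {A B : Matrix n n ℂ} (h : A ≤ B) (k : n) : (A k k).re ≤ (B k k).re := by
  simpa using (Complex.nonneg_iff.mp ((le_iff.mp h).diag_nonneg (i := k))).1

theorem conj_le_conj [Finite m] [Fintype n] {A B : Matrix n n ℂ} (h : A ≤ B) (C : Matrix m n ℂ) :
    C * A * Cᴴ ≤ C * B * Cᴴ := by
  rw [le_iff, ← Matrix.sub_mul, ← Matrix.mul_sub]
  exact (le_iff.mp h).mul_mul_conjTranspose_same C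

variable [Fintype m]

theorem re_conjTranspose_mul_diagonal_mul_apply_self [DecidableEq m] (Z : Matrix m n ℂ)
    (r : m → ℝ) (k : n) :
    ((Zᴴ * diagonal (fun l => (r l : ℂ)) * Z) k k).re = ∑ l, ‖Z l k‖ ^ 2 * r l := by
  have h : ∀ l, star (Z l k) * r l * Z l k = ((‖Z l k‖ ^ 2 * r l : ℝ) : ℂ) := fun l => by
    rw [mul_right_comm, Complex.star_def, Complex.conj_mul']
    push_cast
    rfl
  rw [mul_apply]
  simp only [mul_diagonal, conjTranspose_apply, h, Complex.re_sum, Complex.ofReal_re]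

theorem re_conjTranspose_mul_self_apply_self (Z : Matrix m n ℂ) (k : n) :
    ((Zᴴ * Z) k k).re = ∑ l, ‖Z l k‖ ^ 2 := by
  classical
  simpa using re_conjTranspose_mul_diagonal_mul_apply_self Z 1 k

theorem nonneg_of_conjTranspose_mul_self_le [DecidableEq n] {Q : Matrix m n ℂ} {r : n → ℝ}
    (h : Qᴴ * Q ≤ diagonal fun i => (r i : ℂ)) (i : n) : 0 ≤ r i := by
  have hle := re_apply_self_le h i
  rw [re_conjTranspose_mul_self_apply_self, diagonal_apply_eq, Complex.ofReal_re] at hle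
  exact (sum_nonneg fun l _ => sq_nonneg _).trans hle

theorem apply_eq_zero_of_conjTranspose_mul_self_le [DecidableEq n] {Q : Matrix m n ℂ} {r : n → ℝ}
    (h : Qᴴ * Q ≤ diagonal fun i => (r i : ℂ)) {i : n} (hi : r i = 0) (l : m) : Q l i = 0 := by
  have hle := re_apply_self_le h i
  rw [re_conjTranspose_mul_self_apply_self, diagonal_apply_eq, hi, Complex.ofReal_re] at hle
  have hzero := (sum_eq_zero_iff_of_nonneg fun l _ => sq_nonneg ‖Q l i‖).mp
    (hle.antisymm (sum_nonneg fun l _ => sq_nonneg _)) l (mem_univ l)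
  exact norm_eq_zero.mp (pow_eq_zero_iff two_ne_zero |>.mp hzero)

variable [Fintype n] [DecidableEq n]

theorem exists_mul_conjTranspose_eq_unitary_conj {ρ U V : Matrix n n ℂ} (hρ : 0 ≤ ρ)
    (hU : U ∈ unitaryGroup n ℂ) (hV : V ∈ unitaryGroup n ℂ) :
    ∃ Q : Matrix n n ℂ, Q * Qᴴ = U * ρ * Uᴴ ∧ Qᴴ * Q = V * ρ * Vᴴ := by
  have hU' : Uᴴ * U = 1 := mem_unitaryGroup_iff'.mp hU
  have hV' : Vᴴ * V = 1 := mem_unitaryGroup_iff'.mp hV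
  have hsqrt : (CFC.sqrt ρ)ᴴ = CFC.sqrt ρ := (CFC.sqrt_nonneg ρ).posSemidef.isHermitian
  refine ⟨U * CFC.sqrt ρ * Vᴴ, ?_, ?_⟩
  · calc U * CFC.sqrt ρ * Vᴴ * (U * CFC.sqrt ρ * Vᴴ)ᴴ =
          U * (CFC.sqrt ρ * (Vᴴ * V) * CFC.sqrt ρ) * Uᴴ := by
          simp only [conjTranspose_mul, conjTranspose_conjTranspose, hsqrt, Matrix.mul_assoc]
      _ = U * ρ * Uᴴ := by rw [hV', Matrix.mul_one, CFC.sqrt_mul_sqrt_self ρ hρ]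
  · calc (U * CFC.sqrt ρ * Vᴴ)ᴴ * (U * CFC.sqrt ρ * Vᴴ) =
          V * (CFC.sqrt ρ * (Uᴴ * U) * CFC.sqrt ρ) * Vᴴ := by
          simp only [conjTranspose_mul, conjTranspose_conjTranspose, hsqrt, Matrix.mul_assoc]
      _ = V * ρ * Vᴴ := by rw [hU', Matrix.mul_one, CFC.sqrt_mul_sqrt_self ρ hρ]

theorem conjTranspose_mul_self_le_one_iff [DecidableEq m] {R : Matrix m n ℂ} :
    Rᴴ * R ≤ 1 ↔ R * Rᴴ ≤ 1 := by
  -- Both sides are Schur complements of the block matrix `[1, R; Rᴴ, 1]`.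
  let : Invertible (1 : Matrix m m ℂ) := invertibleOne
  let : Invertible (1 : Matrix n n ℂ) := invertibleOne
  have h₁ := PosDef.fromBlocks₁₁ R 1 (PosDef.one (R := ℂ) (n := m))
  have h₂ := PosDef.fromBlocks₂₂ 1 R (PosDef.one (R := ℂ) (n := n))
  rw [inv_one, Matrix.mul_one] at h₁ h₂
  rw [le_iff, le_iff, ← h₁, h₂]

theorem exists_contraction_of_conjTranspose_mul_self_le [DecidableEq m] {Q : Matrix m n ℂ}
    {r : n → ℝ} (h : Qᴴ * Q ≤ diagonal fun i => (r i : ℂ)) :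
    ∃ R : Matrix m n ℂ, R * Rᴴ ≤ 1 ∧ R * diagonal (fun i => (r i : ℂ)) * Rᴴ = Q * Qᴴ ∧
      ∀ i, (Rᴴ * R) i i * r i = (Qᴴ * Q) i i := by
  -- `R = Q r^(-1/2)`; where `r i = 0` the inverse is `0`, but there column `i` of `Q` vanishes.
  set s : n → ℝ := fun i => (√(r i))⁻¹
  set S : Matrix n n ℂ := diagonal fun i => (s i : ℂ)
  set T : Matrix n n ℂ := diagonal fun i => (r i : ℂ)
  have hS : Sᴴ = S := by simp [S, diagonal_conjTranspose, Pi.star_def]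
  have hsrs : S * T * S = diagonal fun i => if r i = 0 then 0 else 1 := by
    simp only [T, S, diagonal_mul_diagonal]
    congr 1
    ext i
    split_ifs with hi
    · simp [hi]
    · rw [← Complex.ofReal_mul, ← Complex.ofReal_mul, mul_right_comm, ← mul_inv,
        Real.mul_self_sqrt (nonneg_of_conjTranspose_mul_self_le h i), inv_mul_cancel₀ hi,
        Complex.ofReal_one]
  have hQ : Q * (S * T * S) = Q := by
    ext l i
    rw [hsrs, mul_diagonal]
    split_ifs with hi
    · rw [mul_zero, apply_eq_zero_of_conjTranspose_mul_self_le h hi]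
    · rw [mul_one]
  refine ⟨Q * S, ?_, ?_, fun i => ?_⟩
  · rw [← conjTranspose_mul_self_le_one_iff]
    calc (Q * S)ᴴ * (Q * S) = S * (Qᴴ * Q) * Sᴴ := by
          simp only [conjTranspose_mul, hS, Matrix.mul_assoc]
      _ ≤ S * T * Sᴴ := conj_le_conj h S
      _ ≤ 1 := by
        rw [hS, hsrs, ← diagonal_one, le_iff, diagonal_sub]
        refine PosSemidef.diagonal fun i => ?_
        split_ifs <;> simp
  · calc Q * S * T * (Q * S)ᴴ = Q * (S * T * S) * Qᴴ := by
          simp only [conjTranspose_mul, hS, Matrix.mul_assoc]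
      _ = Q * Qᴴ := by rw [hQ]
  · have hcomm : S * T * S = S * S * T := by
      simp only [S, T, diagonal_mul_diagonal, mul_right_comm]
    calc ((Q * S)ᴴ * (Q * S)) i i * r i = (Qᴴ * (Q * (S * T * S))) i i := by
          rw [hcomm, conjTranspose_mul, hS]
          simp only [S, T, ← Matrix.mul_assoc, mul_diagonal]
          simp only [Matrix.mul_assoc, diagonal_mul]
          ring
      _ = (Qᴴ * Q) i i := by rw [hQ]

theorem exists_substochastic_of_conjTranspose_mul_self_le {Q : Matrix m n ℂ} {r : n → ℝ}
    (h : Qᴴ * Q ≤ diagonal fun i => (r i : ℂ)) :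
    ∃ D : m → n → ℝ, (∀ k i, 0 ≤ D k i) ∧ (∀ k, ∑ i, D k i ≤ 1) ∧
      (∀ i, (∑ k, D k i) * r i = ((Qᴴ * Q) i i).re) ∧
      ∀ k, ((Q * Qᴴ) k k).re = ∑ i, D k i * r i := by
  classical
  obtain ⟨R, hR, hRr, hRdiag⟩ := exists_contraction_of_conjTranspose_mul_self_le h
  refine ⟨fun k i => ‖R k i‖ ^ 2, fun k i => sq_nonneg _, fun k => ?_, fun i => ?_, fun k => ?_⟩
  · have hrow := re_conjTranspose_mul_self_apply_self Rᴴ k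
    simp only [conjTranspose_conjTranspose, conjTranspose_apply, norm_star] at hrow
    simpa [← hrow] using re_apply_self_le hR k
  · rw [← re_conjTranspose_mul_self_apply_self, ← hRdiag, Complex.re_mul_ofReal]
  · have hdiag := re_conjTranspose_mul_diagonal_mul_apply_self Rᴴ r k
    simpa only [conjTranspose_conjTranspose, hRr, conjTranspose_apply, norm_star] using hdiag

end Loewner

section ReductionCriterion

variable {a b : Type*} [Fintype b]

theorem IsUnitVector.star_dotProduct_self {φ : b → ℂ} (hφ : IsUnitVector φ) :
    star φ ⬝ᵥ φ = 1 := by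
  simp only [dotProduct, Pi.star_apply, Complex.star_def, Complex.conj_mul']
  exact_mod_cast hφ

theorem pureState_le_one [DecidableEq b] {φ : b → ℂ} (hφ : IsUnitVector φ) : pureState φ ≤ 1 := by
  have hcol : (replicateCol Unit φ)ᴴ * replicateCol Unit φ = 1 := by
    ext
    simp [conjTranspose_replicateCol, hφ.star_dotProduct_self]
  rw [pureState, vecMulVec_eq Unit, ← conjTranspose_replicateCol]
  exact conjTranspose_mul_self_le_one_iff.mp hcol.le

theorem marginalFst_sum_smul_kronecker {ι : Type*} [Fintype ι] (p : ι → ℂ) (A : ι → Matrix a a ℂ)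
    (B : ι → Matrix b b ℂ) :
    marginalFst (∑ i, p i • (A i ⊗ₖ B i)) = ∑ i, p i • (B i).trace • A i := by
  ext j k
  simp only [marginalFst, of_apply, Matrix.sum_apply, Matrix.smul_apply, kronecker_apply,
    smul_eq_mul, trace, diag_apply, sum_mul, mul_sum]
  rw [sum_comm]
  simp only [mul_comm (A _ _ _)]

variable [Fintype a]

/-- The reduction criterion `ρ ≤ ρ_a ⊗ 1` (in the Loewner order) with respect to the first factor
for a state `ρ` on `ℂᵃ ⊗ ℂᵇ`: a necessary condition for separability, and the only property of
separable states used to bound `thermoGap`. -/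
def SatisfiesReductionCriterion [DecidableEq b] (ρ : Matrix (a × b) (a × b) ℂ) : Prop :=
  ρ ≤ marginalFst ρ ⊗ₖ 1

theorem IsSeparable.satisfiesReductionCriterion [DecidableEq b] {ρ : Matrix (a × b) (a × b) ℂ}
    (h : IsSeparable ρ) : SatisfiesReductionCriterion ρ := by
  obtain ⟨N, p, ψ, φ, hp, -, -, hφ, rfl⟩ := h
  have htr : ∀ i, (pureState (φ i)).trace = 1 := fun i => by
    rw [pureState, trace_vecMulVec, dotProduct_comm, (hφ i).star_dotProduct_self]
  have hgap : marginalFst (∑ i, (p i : ℂ) • (pureState (ψ i) ⊗ₖ pureState (φ i))) ⊗ₖ 1 -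
      ∑ i, (p i : ℂ) • (pureState (ψ i) ⊗ₖ pureState (φ i)) =
      ∑ i, (p i : ℂ) • (pureState (ψ i) ⊗ₖ (1 - pureState (φ i))) := by
    rw [marginalFst_sum_smul_kronecker]
    ext ⟨i, k⟩ ⟨j, l⟩
    simp [htr, Matrix.sum_apply, sum_mul, mul_sub, mul_assoc]
  rw [SatisfiesReductionCriterion, le_iff, hgap]
  exact posSemidef_sum _ fun i _ =>
    ((posSemidef_vecMulVec_self_star (ψ i)).kronecker (pureState_le_one (hφ i))).smul
      (Complex.zero_le_real.mpr (hp i))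

variable [DecidableEq b]

theorem marginalFst_kronecker_one_conj (W : Matrix a a ℂ) (ρ : Matrix (a × b) (a × b) ℂ) :
    marginalFst ((W ⊗ₖ 1) * ρ * (W ⊗ₖ 1)ᴴ) = W * marginalFst ρ * Wᴴ := by
  have hleft : ∀ (A : Matrix (a × b) (a × b) ℂ) i c x,
      ((W ⊗ₖ (1 : Matrix b b ℂ)) * A) (i, c) x = ∑ k, W i k * A (k, c) x := fun A i c x => by
    simp [mul_apply, Fintype.sum_prod_type, one_apply]
  have hright : ∀ (A : Matrix (a × b) (a × b) ℂ) x j c,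
      (A * (W ⊗ₖ (1 : Matrix b b ℂ))ᴴ) x (j, c) = ∑ k, A x (k, c) * Wᴴ k j := fun A x j c => by
    simp [mul_apply, Fintype.sum_prod_type, one_apply, apply_ite star]
  ext i j
  simp only [marginalFst, of_apply, hright, hleft, mul_apply, sum_mul, mul_sum]
  rw [sum_comm]
  exact sum_congr rfl fun k _ => sum_comm

theorem SatisfiesReductionCriterion.kronecker_one_conj {ρ : Matrix (a × b) (a × b) ℂ}
    (h : SatisfiesReductionCriterion ρ) (W : Matrix a a ℂ) :
    SatisfiesReductionCriterion ((W ⊗ₖ 1) * ρ * (W ⊗ₖ 1)ᴴ) := by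
  have hmarg : (W * marginalFst ρ * Wᴴ) ⊗ₖ (1 : Matrix b b ℂ) =
      (W ⊗ₖ 1) * (marginalFst ρ ⊗ₖ 1) * (W ⊗ₖ 1)ᴴ := by
    rw [conjTranspose_kronecker, ← mul_kronecker_mul, ← mul_kronecker_mul, conjTranspose_one,
      Matrix.mul_one, Matrix.mul_one]
  rw [SatisfiesReductionCriterion, marginalFst_kronecker_one_conj, hmarg]
  exact conj_le_conj h _

variable [DecidableEq a]

theorem SatisfiesReductionCriterion.exists_substochastic {ρ : Matrix (a × b) (a × b) ℂ}
    (hred : SatisfiesReductionCriterion ρ) (hρ : 0 ≤ ρ) {W : Matrix a a ℂ} {ν : a → ℝ}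
    (hWu : W ∈ unitaryGroup a ℂ) (hW : W * marginalFst ρ * Wᴴ = diagonal fun j => (ν j : ℂ))
    {U : Matrix (a × b) (a × b) ℂ} (hU : U ∈ unitaryGroup (a × b) ℂ) :
    ∃ D : a × b → a → ℝ, (∀ k j, 0 ≤ D k j) ∧ (∀ k, ∑ j, D k j ≤ 1) ∧
      (∀ j, ν j ≠ 0 → ∑ k, D k j = 1) ∧ ∀ k, ((U * ρ * Uᴴ) k k).re = ∑ j, D k j * ν j := by
  obtain ⟨Q, hQQ', hQ'Q⟩ := exists_mul_conjTranspose_eq_unitary_conj hρ hU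
    (kronecker_mem_unitary hWu (Submonoid.one_mem (unitaryGroup b ℂ)))
  have hmarg : marginalFst (Qᴴ * Q) = diagonal fun j => (ν j : ℂ) := by
    rw [hQ'Q, marginalFst_kronecker_one_conj, hW]
  have hle : Qᴴ * Q ≤ diagonal fun l : a × b => (ν l.1 : ℂ) := by
    have := hred.kronecker_one_conj W
    rw [← hQ'Q, SatisfiesReductionCriterion, hmarg, ← diagonal_one,
      diagonal_kronecker_diagonal] at this
    simpa using this
  obtain ⟨D, hD, hrow, hcol, hdiag⟩ := exists_substochastic_of_conjTranspose_mul_self_le hle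
  refine ⟨fun k j => ∑ c, D k (j, c), fun k j => sum_nonneg fun c _ => hD k _, fun k => ?_,
    fun j hj => ?_, fun k => ?_⟩
  · rw [← Fintype.sum_prod_type]
    exact hrow k
  · have hν : ∑ c, (∑ k, D k (j, c)) * ν j = ν j := by
      rw [sum_congr rfl fun c _ => hcol (j, c), ← Complex.re_sum]
      simpa [marginalFst] using congrArg Complex.re (congrFun₂ hmarg j j)
    rw [sum_comm]
    rw [← sum_mul] at hν
    exact mul_right_cancel₀ hj (hν.trans (one_mul _).symm)
  · rw [← hQQ', hdiag, Fintype.sum_prod_type]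
    simp only [sum_mul]

end ReductionCriterion

section Energy

variable {a b n : Type*} [Fintype a] [Fintype b] [Fintype n]

theorem isDensityMatrix_marginalFst {ρ : Matrix (a × b) (a × b) ℂ} (hρ : IsDensityMatrix ρ) :
    IsDensityMatrix (marginalFst ρ) := by
  have hsum : marginalFst ρ = ∑ k, ρ.submatrix (·, k) (·, k) := by
    ext i j
    simp [marginalFst, Matrix.sum_apply]
  refine ⟨hsum ▸ posSemidef_sum _ fun k _ => hρ.1.submatrix _, ?_⟩
  rw [← hρ.2]
  simp [trace, marginalFst, Fintype.sum_prod_type]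

variable [DecidableEq n]

theorem exists_mem_unitaryGroup_diagonal_antitone {M : Matrix n n ℂ} (hM : M.IsHermitian) {d : ℕ}
    (f : Fin d ≃ n) :
    ∃ W ∈ unitaryGroup n ℂ, ∃ ν : n → ℝ,
      W * M * Wᴴ = diagonal (fun j => (ν j : ℂ)) ∧ Antitone (ν ∘ f) := by
  set V : Matrix n n ℂ := (hM.eigenvectorUnitary : Matrix n n ℂ)
  have hV : Vᴴ * V = 1 := mem_unitaryGroup_iff'.mp hM.eigenvectorUnitary.2
  have hspec : Vᴴ * M * V = diagonal fun j => (hM.eigenvalues j : ℂ) := by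
    simpa [Unitary.conjStarAlgAut_apply, V, star_eq_conjTranspose, Function.comp_def] using
      hM.conjStarAlgAut_star_eigenvectorUnitary
  set τ : Equiv.Perm n := (f.symm.trans (Tuple.sort fun i => -hM.eigenvalues (f i))).trans f
  refine ⟨Vᴴ.submatrix τ id, ?_, hM.eigenvalues ∘ τ, ?_, fun i j hij => ?_⟩
  · rw [mem_unitaryGroup_iff, star_eq_conjTranspose, conjTranspose_submatrix,
      conjTranspose_conjTranspose, ← submatrix_mul _ _ _ _ _ Function.bijective_id, hV]
    exact submatrix_one_equiv τ
  · calc Vᴴ.submatrix τ id * M * (Vᴴ.submatrix τ id)ᴴ = (Vᴴ * M * V).submatrix τ τ := by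
          ext i j
          simp [mul_apply]
      _ = diagonal fun j => ((hM.eigenvalues ∘ τ) j : ℂ) := by
          rw [hspec]
          exact submatrix_diagonal_equiv _ τ
  · simpa [τ] using Tuple.monotone_sort (fun i => -hM.eigenvalues (f i)) hij

theorem energy_diagonal (e : n → ℝ) (σ : Matrix n n ℂ) :
    energy (diagonal fun k => (e k : ℂ)) σ = ∑ k, e k * (σ k k).re := by
  simp [energy, trace, mul_diagonal, Complex.re_sum, mul_comm]

theorem passiveEnergy_le (H σ : Matrix n n ℂ) {V : Matrix n n ℂ} (hV : V ∈ unitaryGroup n ℂ) :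
    passiveEnergy H σ ≤ energy H (V * σ * Vᴴ) :=
  (exists_energy_eq_passiveEnergy H σ).choose_spec.2 ⟨V, hV⟩

variable [DecidableEq a] [DecidableEq b] {ρ : Matrix (a × b) (a × b) ℂ}

theorem thermoGap_diagonal (x : a → ℝ) (y : b → ℝ) (ρ : Matrix (a × b) (a × b) ℂ) :
    thermoGap (diagonal fun k => ((x k.1 + y k.2 : ℝ) : ℂ)) (diagonal fun i => (x i : ℂ))
        (diagonal fun j => (y j : ℂ)) ρ =
      passiveEnergy (diagonal fun i => (x i : ℂ)) (marginalFst ρ) -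
        passiveEnergy (diagonal fun k => ((x k.1 + y k.2 : ℝ) : ℂ)) ρ +
        groundEnergy (diagonal fun j => (y j : ℂ)) := by
  have hadd : energy (diagonal fun k => ((x k.1 + y k.2 : ℝ) : ℂ)) ρ =
      energy (diagonal fun i => (x i : ℂ)) (marginalFst ρ) +
        energy (diagonal fun j => (y j : ℂ)) (marginalSnd ρ) := by
    simp only [energy_diagonal, marginalFst, marginalSnd, of_apply, Complex.re_sum, mul_sum,
      Fintype.sum_prod_type, add_mul, sum_add_distrib]
    rw [add_right_inj]
    exact sum_comm
  rw [thermoGap, ergotropy, ergotropy, hadd]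
  ring

theorem SatisfiesReductionCriterion.sum_mul_le_passiveEnergy
    (hred : SatisfiesReductionCriterion ρ) (hρ : 0 ≤ ρ) {W : Matrix a a ℂ} {ν : a → ℝ}
    (hWu : W ∈ unitaryGroup a ℂ) (hW : W * marginalFst ρ * Wᴴ = diagonal fun j => (ν j : ℂ))
    (hν : ∀ j, 0 ≤ ν j) {d : ℕ} {f : Fin d ≃ a} (hanti : Antitone (ν ∘ f)) {c : Fin d → ℝ}
    {e : a × b → ℝ} (hc : ∀ (i : Fin d) (S : Finset (a × b)), #S = (i : ℕ) + 1 →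
      ∑ j ∈ Iic i, c j ≤ ∑ k ∈ S, e k) :
    ∑ i, c i * ν (f i) ≤ passiveEnergy (diagonal fun k => (e k : ℂ)) ρ := by
  refine le_ciInf fun U => ?_
  obtain ⟨D, hD, hrow, hcol, hdiag⟩ := hred.exists_substochastic hρ hWu hW U.2
  simp only [energy_diagonal, hdiag, ← f.sum_comp] at hrow ⊢
  exact sum_mul_le_sum_mul_of_substochastic (D := fun k i => D k (f i)) hanti (fun i => hν (f i))
    (fun k i => hD k (f i)) hrow (fun i => hcol (f i)) hc

theorem SatisfiesReductionCriterion.thermoGap_diagonal_le (hred : SatisfiesReductionCriterion ρ)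
    (hρ : IsDensityMatrix ρ) {x : a → ℝ} {y : b → ℝ} {d : ℕ} (f : Fin d ≃ a) {K : ℝ}
    (hK : ∀ (i : Fin d) (S : Finset (a × b)), #S = (i : ℕ) + 1 →
      ∑ j ∈ Iic i, (x (f j) + groundEnergy (diagonal fun j => (y j : ℂ)) - K) ≤
        ∑ k ∈ S, (x k.1 + y k.2)) :
    thermoGap (diagonal fun k => ((x k.1 + y k.2 : ℝ) : ℂ)) (diagonal fun i => (x i : ℂ))
      (diagonal fun j => (y j : ℂ)) ρ ≤ K := by
  obtain ⟨hpsd, htr⟩ := isDensityMatrix_marginalFst hρ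
  obtain ⟨W, hWu, ν, hW, hanti⟩ := exists_mem_unitaryGroup_diagonal_antitone hpsd.isHermitian f
  have hν : ∀ j, 0 ≤ ν j := fun j => by
    have hdiag := (hpsd.mul_mul_conjTranspose_same W).diag_nonneg (i := j)
    rw [hW, diagonal_apply_eq] at hdiag
    exact Complex.zero_le_real.mp hdiag
  have hsum : ∑ i, ν (f i) = 1 := by
    have htrace := congrArg trace hW
    rw [trace_mul_comm, ← Matrix.mul_assoc, ← star_eq_conjTranspose, mem_unitaryGroup_iff'.mp hWu,
      Matrix.one_mul, htr, trace_diagonal, ← f.sum_comp] at htrace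
    exact_mod_cast htrace.symm
  have hupper := passiveEnergy_le (diagonal fun i => (x i : ℂ)) (marginalFst ρ) hWu
  rw [hW, energy_diagonal, ← f.sum_comp] at hupper
  have hlower := hred.sum_mul_le_passiveEnergy (nonneg_iff_posSemidef.mpr hρ.1) hWu hW hν hanti hK
  simp only [sub_mul, add_mul, sum_sub_distrib, sum_add_distrib, ← mul_sum, hsum, mul_one]
    at hlower
  simp only [diagonal_apply_eq, Complex.ofReal_re] at hupper
  rw [thermoGap_diagonal]
  linarith

end Energy

section Qubits

/-- The numbers `(m₁, m₂, m₃)` of levels in `S` in which qubit 1, 2, 3 is excited, for a set `S`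
of three-qubit energy levels: the total excitation energy of `S` is `m₁ α₁ + m₂ α₂ + m₃ α₃`. -/
def occupation (S : Finset ((Fin 2 × Fin 2) × Fin 2)) : ℕ × ℕ × ℕ :=
  ∑ k ∈ S, ((k.1.1 : ℕ), (k.1.2 : ℕ), (k.2 : ℕ))

theorem occupation_of_card_eq_two : ∀ S, #S = 2 →
    (1, 0, 0) ≤ occupation S ∨ (0, 1, 0) ≤ occupation S ∨ (0, 0, 1) ≤ occupation S := by
  decide +kernel

theorem occupation_of_card_eq_three : ∀ S, #S = 3 →
    (1, 1, 0) ≤ occupation S ∨ (1, 0, 1) ≤ occupation S ∨ (0, 1, 1) ≤ occupation S := by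
  decide +kernel

theorem occupation_of_card_eq_four : ∀ S, #S = 4 →
    (1, 1, 1) ≤ occupation S ∨ (2, 2, 0) ≤ occupation S ∨ (2, 0, 2) ≤ occupation S ∨
      (0, 2, 2) ≤ occupation S := by
  decide +kernel

variable {E₁ E₂ E₃ α₁ α₂ α₃ : ℝ}

theorem le_sum_energy_of_le_occupation (hα₁ : 0 ≤ α₁) (hα₂ : 0 ≤ α₂) (hα₃ : 0 ≤ α₃)
    {S : Finset ((Fin 2 × Fin 2) × Fin 2)} {m₁ m₂ m₃ : ℕ} (h : (m₁, m₂, m₃) ≤ occupation S) :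
    #S * (E₁ + E₂ + E₃) + m₁ * α₁ + m₂ * α₂ + m₃ * α₃ ≤
      ∑ k ∈ S, (E₁ + (k.1.1 : ℕ) * α₁ + (E₂ + (k.1.2 : ℕ) * α₂) + (E₃ + (k.2 : ℕ) * α₃)) := by
  simp only [occupation, Prod.le_def, Prod.fst_sum, Prod.snd_sum] at h
  obtain ⟨h₁, h₂, h₃⟩ := h
  calc #S * (E₁ + E₂ + E₃) + m₁ * α₁ + m₂ * α₂ + m₃ * α₃
      ≤ #S * (E₁ + E₂ + E₃) + (∑ k ∈ S, (k.1.1 : ℕ) : ℕ) * α₁ +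
          (∑ k ∈ S, (k.1.2 : ℕ) : ℕ) * α₂ + (∑ k ∈ S, (k.2 : ℕ) : ℕ) * α₃ := by gcongr
    _ = _ := by
      push_cast
      simp only [sum_add_distrib, sum_const, nsmul_eq_mul, sum_mul]
      ring

theorem exists_enumeration_of_energies (E₁ E₂ α₁ α₂ : ℝ) :
    ∃ f : Fin 4 ≃ Fin 2 × Fin 2, ∀ i,
      ∑ j ∈ Iic i, (E₁ + ((f j).1 : ℕ) * α₁ + (E₂ + ((f j).2 : ℕ) * α₂)) =
        (i + 1 : ℕ) * (E₁ + E₂) + ![0, min α₁ α₂, α₁ + α₂, 2 * (α₁ + α₂)] i := by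
  have hIic (u : Fin 4 → ℝ) (i : Fin 4) : ∑ j ∈ Iic i, u j =
      ![u 0, u 0 + u 1, u 0 + u 1 + u 2, u 0 + u 1 + u 2 + u 3] i := by
    rw [← filter_ge_eq_Iic, sum_filter, Fin.sum_univ_four]
    fin_cases i <;> simp
  obtain ⟨g, hg₀, hg₁, hg₂, hg₃⟩ : ∃ g : Fin 4 ≃ Fin 2 × Fin 2,
      g 0 = (0, 0) ∧ g 1 = (0, 1) ∧ g 2 = (1, 0) ∧ g 3 = (1, 1) :=
    ⟨(finProdFinEquiv (m := 2) (n := 2)).symm, by decide⟩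
  rcases le_total α₁ α₂ with h | h
  · refine ⟨g.trans (Equiv.prodComm _ _), fun i => ?_⟩
    rw [hIic, min_eq_left h]
    simp only [Equiv.trans_apply, hg₀, hg₁, hg₂, hg₃, Equiv.prodComm_apply, Prod.swap, Fin.val_zero,
      Fin.val_one]
    fin_cases i <;> push_cast <;> ring
  · refine ⟨g, fun i => ?_⟩
    rw [hIic, min_eq_right h]
    simp only [hg₀, hg₁, hg₂, hg₃, Fin.val_zero, Fin.val_one]
    fin_cases i <;> push_cast <;> ring

theorem hamiltonian₂_eq_diagonal (E₁ E₂ α₁ α₂ : ℝ) :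
    hamiltonian₂ (qubitHamiltonian E₁ α₁) (qubitHamiltonian E₂ α₂) = diagonal fun x =>
      ((E₁ + (x.1 : ℕ) * α₁ + (E₂ + (x.2 : ℕ) * α₂) : ℝ) : ℂ) := by
  rw [hamiltonian₂, qubitHamiltonian, qubitHamiltonian, ← diagonal_one,
    diagonal_kronecker_diagonal, diagonal_kronecker_diagonal, diagonal_add]
  simp only [mul_one, one_mul, Complex.ofReal_add]

theorem hamiltonian₃_eq_diagonal (E₁ E₂ E₃ α₁ α₂ α₃ : ℝ) :
    hamiltonian₃ (qubitHamiltonian E₁ α₁) (qubitHamiltonian E₂ α₂) (qubitHamiltonian E₃ α₃) =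
      diagonal fun x => ((E₁ + (x.1.1 : ℕ) * α₁ + (E₂ + (x.1.2 : ℕ) * α₂) +
        (E₃ + (x.2 : ℕ) * α₃) : ℝ) : ℂ) := by
  rw [hamiltonian₃, qubitHamiltonian, qubitHamiltonian, qubitHamiltonian, ← diagonal_one]
  simp only [diagonal_kronecker_diagonal, diagonal_add]
  simp

theorem SatisfiesReductionCriterion.delta12_3_le
    {ρ : Matrix ((Fin 2 × Fin 2) × Fin 2) ((Fin 2 × Fin 2) × Fin 2) ℂ}
    (hred : SatisfiesReductionCriterion ρ) (hρ : IsDensityMatrix ρ) (hα₁ : 0 ≤ α₁) (hα₂ : 0 ≤ α₂)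
    (hα₃ : 0 ≤ α₃) {K : ℝ} (hK : 0 ≤ K) (h₁ : α₁ - α₃ ≤ 2 * K) (h₂ : α₂ - α₃ ≤ 2 * K)
    (h₁₂ : α₁ + α₂ - α₃ ≤ 4 * K) : delta12_3 E₁ E₂ E₃ α₁ α₂ α₃ ρ ≤ K := by
  obtain ⟨f, hf⟩ := exists_enumeration_of_energies E₁ E₂ α₁ α₂
  have hground : groundEnergy (diagonal fun j : Fin 2 => ((E₃ + (j : ℕ) * α₃ : ℝ) : ℂ)) = E₃ :=
    groundEnergy_qubitHamiltonian E₃ α₃ hα₃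
  rw [delta12_3, hamiltonian₂_eq_diagonal, hamiltonian₃_eq_diagonal]
  refine hred.thermoGap_diagonal_le
    (x := fun i => E₁ + (i.1 : ℕ) * α₁ + (E₂ + (i.2 : ℕ) * α₂))
    (y := fun j => E₃ + (j : ℕ) * α₃) hρ f fun i S hS => ?_
  simp only [add_sub_assoc, hground, sum_add_distrib (g := fun _ => E₃ - K), hf, sum_const,
    nsmul_eq_mul, Fin.card_Iic]
  have hle {m₁ m₂ m₃ : ℕ} := le_sum_energy_of_le_occupation (E₁ := E₁) (E₂ := E₂) (E₃ := E₃)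
    hα₁ hα₂ hα₃ (S := S) (m₁ := m₁) (m₂ := m₂) (m₃ := m₃)
  rw [hS] at hle
  have hmin₁ := min_le_left α₁ α₂
  have hmin₂ := min_le_right α₁ α₂
  fin_cases i <;> push_cast at hle ⊢
  · have h := hle (m₁ := 0) (m₂ := 0) (m₃ := 0) zero_le
    push_cast at h
    linarith
  · rcases occupation_of_card_eq_two S hS with h | h | h <;>
      replace h := hle h <;> push_cast at h <;> linarith
  · rcases occupation_of_card_eq_three S hS with h | h | h <;>
      replace h := hle h <;> push_cast at h <;> linarith
  · rcases occupation_of_card_eq_four S hS with h | h | h | h <;>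
      replace h := hle h <;> push_cast at h <;> linarith

end Qubits

end QubitErgotropy

theorem proposition3_general (E₁ E₂ E₃ α₁ α₂ α₃ : ℝ) (hα₁ : 0 ≤ α₁) (hα₂ : 0 ≤ α₂)
    (hα₃ : 0 ≤ α₃) (ρ : Matrix ((Fin 2 × Fin 2) × Fin 2) ((Fin 2 × Fin 2) × Fin 2) ℂ)
    (hρ : QubitErgotropy.IsDensityMatrix ρ)
    (hred : QubitErgotropy.SatisfiesReductionCriterion ρ) :
    QubitErgotropy.delta12_3 E₁ E₂ E₃ α₁ α₂ α₃ ρ ≤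
      max 0 (max ((α₁ + α₂ - α₃) / 4) ((max α₁ α₂ - α₃) / 2)) := by
  have hmax := le_max_left ((α₁ + α₂ - α₃) / 4) ((max α₁ α₂ - α₃) / 2)
  exact hred.delta12_3_le hρ hα₁ hα₂ hα₃ (le_max_left _ _) (by grind) (by grind) (by grind)

theorem proposition3 (E₁ E₂ E₃ α₁ α₂ α₃ : ℝ) (hα₁ : 0 < α₁) (hα₂ : 0 < α₂) (hα₃ : 0 < α₃)
    (ρ : Matrix ((Fin 2 × Fin 2) × Fin 2) ((Fin 2 × Fin 2) × Fin 2) ℂ)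
    (hρ : QubitErgotropy.IsDensityMatrix ρ) (hsep : QubitErgotropy.IsSeparable ρ) :
    (∀ α : ℝ, α₁ < α → α₂ = α → α₃ = α →
      QubitErgotropy.delta12_3 E₁ E₂ E₃ α₁ α₂ α₃ ρ ≤ α₁ / 4) ∧
    (∀ α : ℝ, α₁ = α → α₂ = α → α₃ < α → 2 / 3 * α ≤ α₃ →
      QubitErgotropy.delta12_3 E₁ E₂ E₃ α₁ α₂ α₃ ρ ≤ (α - α₃) / 4 + α / 4) ∧
    (∀ α : ℝ, α₁ = α → α₂ = α → α₃ < α → α₃ ≤ 2 / 3 * α →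
      QubitErgotropy.delta12_3 E₁ E₂ E₃ α₁ α₂ α₃ ρ ≤ (α - α₃) / 2 + α / 6) := by
  have h := proposition3_general E₁ E₂ E₃ α₁ α₂ α₃ hα₁.le hα₂.le hα₃.le ρ hρ
    hsep.satisfiesReductionCriterion
  refine ⟨?_, ?_, ?_⟩ <;> intros <;> exact h.trans (by grind)
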